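/- Let $N\ge 1$, let $p_1,\dots,p_N>0$ with $\sum_n p_n=1$, and let $\rho=\operatorname{diag}(p_1,\dots,p_N)$. For real vectors $a=(a_1,\dots,a_N)$ and $h=(h_1,\dots,h_N)$ let $L$ be the real tridiagonal $N\times N$ matrix with $$L_{n,n}=a_n,\qquad L_{n,n+1}=\sqrt{p_n},\qquad L_{n+1,n}=\sqrt{p_{n+1}},$$ and let $H$ be the quintdiagonal Hermitian matrix with $H_{n,n}=h_n$, $$H_{n,n+1}=\overline{H_{n+1,n}}=-\frac{i}{2}\,\frac{\sqrt{p_n}-\sqrt{p_{n+1}}}{\sqrt{p_n}+\sqrt{p_{n+1}}}\,\bigl(a_n\sqrt{p_n}+a_{n+1}\sqrt{p_{n+1}}\bigr),$$ $$H_{n,n+2}=\overline{H_{n+2,n}}=-\frac{i}{2}\,p_{n+1}\,\frac{\sqrt{p_n}-\sqrt{p_{n+2}}}{\sqrt{p_n}+\sqrt{p_{n+2}}},$$ all other entries of $L$ and $H$ being zero. Consider the Lindblad equation $$\dot\sigma=-i[H,\sigma]+L\sigma L^\dagger-\tfrac12\{L^\dagger L,\sigma\}$$ on the set of density matrices (positive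 semidefinite matrices of trace one). A density matrix is called globally asymptotically stable (GAS) if it is a stationary state that is Lyapunov stable and to which every solution starting at a density matrix converges as $t\to\infty$. Then: 1. For all $a,h\in\mathbb R^N$, $\rho$ is a stationary state of the Lindblad equation. 2. $\rho$ is GAS for most choices of $a$ and $h$: there is a closed set $Z\subset\mathbb R^N\times\mathbb R^N$ of Lebesgue measure zero such that $\rho$ is GAS whenever $(a,h)\notin Z$ (in particular, for an open dense set of full measure of pairs $(a,h)$). 3. For every $a\in\mathbb R^N$ there is $M_0\ge 0$ such that $\rho$ is GAS for $h=(M,0,\dots,0)$ for all $M>M_0$. -/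

import Mathlib

open scoped ComplexOrder Topology

noncomputable section

namespace LindbladStab

/-- The right-hand side `-i[H,X] + L X L† - (1/2){L†L, X}` of the Lindblad master equation. -/
def generator {N : ℕ} (H L X : Matrix (Fin N) (Fin N) ℂ) : Matrix (Fin N) (Fin N) ℂ :=
  (-Complex.I) • (H * X - X * H) + L * X * L.conjTranspose
    - (1 / 2 : ℂ) • (L.conjTranspose * L * X + X * (L.conjTranspose * L))

/-- Density matrices: positive semidefinite of trace one. -/
def IsDensity {N : ℕ} (X : Matrix (Fin N) (Fin N) ℂ) : Prop :=
  X.PosSemidef ∧ X.trace = 1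

/-- A density matrix at which the right-hand side of the Lindblad equation vanishes. -/
def IsStationaryState {N : ℕ} (H L ρ : Matrix (Fin N) (Fin N) ℂ) : Prop :=
  IsDensity ρ ∧ generator H L ρ = 0

/-- `σ`, restricted to `[0, ∞)`, solves the Lindblad equation with an initial value that is a
density matrix (at time `0` the derivative is one-sided). -/
def IsTrajectory {N : ℕ} (H L : Matrix (Fin N) (Fin N) ℂ)
    (σ : ℝ → Matrix (Fin N) (Fin N) ℂ) : Prop :=
  IsDensity (σ 0) ∧
    ∀ t : ℝ, 0 ≤ t → HasDerivWithinAt σ (generator H L (σ t)) (Set.Ici 0) t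

/-- Global asymptotic stability of `ρ` for the Lindblad equation on the set of density matrices:
`ρ` is an equilibrium, it is stable in the sense of Lyapunov, and every trajectory converges to it.
The field `exists_trajectory` records that the dynamics is defined for every initial state, so
that the other two clauses are not empty. -/
structure IsGAS {N : ℕ} (H L ρ : Matrix (Fin N) (Fin N) ℂ) : Prop where
  stationary : IsStationaryState H L ρ
  exists_trajectory : ∀ ρ₀, IsDensity ρ₀ → ∃ σ, IsTrajectory H L σ ∧ σ 0 = ρ₀
  stable : ∀ U ∈ 𝓝 ρ, ∃ V ∈ 𝓝 ρ, ∀ σ, IsTrajectory H L σ → σ 0 ∈ V → ∀ t : ℝ, 0 ≤ t → σ t ∈ U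
  attractive : ∀ σ, IsTrajectory H L σ → Filter.Tendsto σ Filter.atTop (𝓝 ρ)

/-- The diagonal matrix `diag(p₁, …, p_N)`. -/
def targetState {N : ℕ} (p : Fin N → ℝ) : Matrix (Fin N) (Fin N) ℂ :=
  Matrix.diagonal fun n => (p n : ℂ)

/-- The tridiagonal matrix with `L_{n,n} = a_n`, `L_{n,n+1} = √p_n`, `L_{n+1,n} = √p_{n+1}`:
both neighbours of the diagonal in row `n` equal `√p_n`. -/
def noiseOp {N : ℕ} (p a : Fin N → ℝ) : Matrix (Fin N) (Fin N) ℂ :=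
  Matrix.of fun m n =>
    if m = n then (a m : ℂ)
    else if (m : ℕ) + 1 = n ∨ (n : ℕ) + 1 = m then (√(p m) : ℂ)
    else 0

/-- The part of the Hamiltonian strictly above the diagonal. -/
def hamUpper {N : ℕ} (p a : Fin N → ℝ) : Matrix (Fin N) (Fin N) ℂ :=
  Matrix.of fun m n =>
    if (m : ℕ) + 1 = n then
      -(Complex.I / 2) *
        (((√(p m) - √(p n)) / (√(p m) + √(p n)) * (a m * √(p m) + a n * √(p n)) : ℝ) : ℂ)
    else if hmn : (m : ℕ) + 2 = n then
      -(Complex.I / 2) *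
        ((p ⟨m + 1, by omega⟩ * ((√(p m) - √(p n)) / (√(p m) + √(p n))) : ℝ) : ℂ)
    else 0

/-- The quintdiagonal Hermitian matrix with diagonal `h` and the given upper part. -/
def ham {N : ℕ} (p a h : Fin N → ℝ) : Matrix (Fin N) (Fin N) ℂ :=
  Matrix.diagonal (fun n => (h n : ℂ)) + hamUpper p a + (hamUpper p a).conjTranspose

theorem ham_isHermitian {N : ℕ} (p a h : Fin N → ℝ) : (ham p a h).IsHermitian := by
  ext i j
  by_cases hij : i = j
  · subst hij; simp [ham, Matrix.conjTranspose_apply]; ring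
  · have hji : j ≠ i := fun e => hij e.symm
    simp [ham, Matrix.conjTranspose_apply, Matrix.diagonal_apply_ne _ hij,
      Matrix.diagonal_apply_ne _ hji, add_comm]

end LindbladStab

end

/-! Write `S` for the square root of `ρ`. The noise operator satisfies the detailed balance relation
`L S = S L†`, and `H` is chosen so that the drift `-iH - L†L/2` is intertwined by `S` with the
Heisenberg drift for `-h`. Hence `X = S Y S` turns the Lindblad generator for `h` into the
Heisenberg generator for `-h` (`generator_sqrtState`). Stationarity of `ρ` is then the identity that
the Heisenberg generator kills `1`.

For stability, let `Y` be a Heisenberg eigenvector with `Re z ≥ 0`. Testing the carré du champ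
identity against the faithful invariant state gives `Re z = 0` and `[Y, L] = 0`. If moreover only
scalars commute with both `H` and `L`, then `Y` is scalar (`scalar_of_heisenberg_eigenvector`), so
on traceless matrices every eigenvalue has negative real part, and finite-dimensional linear theory
gives GAS.

It remains to see when the commutant is trivial. The first basis vector is cyclic for `L`, so a
matrix commuting with `L` is determined by its first column. Moving only the first entry of `h`,
failure becomes an eigenvalue condition on a fixed operator, hence has finitely many solutions
(`finite_not_trivialCommutant`). This gives the third claim directly, and the second by integrating
over lines. -/

noncomputable section

namespace LindbladStab

/-! ### Linear differential equations with decaying eigenvalues -/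

section Exponential

open Filter NormedSpace

/-- Powers of an element of a complex Banach algebra with spectrum in the open unit disc tend
to zero. -/
theorem tendsto_pow_of_spectrum {𝔸 : Type*} [NormedRing 𝔸] [NormedAlgebra ℂ 𝔸] [CompleteSpace 𝔸]
    [Nontrivial 𝔸] (Φ : 𝔸) (h : ∀ μ ∈ spectrum ℂ Φ, ‖μ‖ < 1) :
    Tendsto (fun n : ℕ => Φ ^ n) atTop (𝓝 0) := by
  have hr : spectralRadius ℂ Φ < 1 := by
    have := spectrum.spectralRadius_lt_of_forall_lt_of_nonempty (spectrum.nonempty Φ) (r := 1)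
      (fun k hk => by simpa [← NNReal.coe_lt_coe] using h k hk)
    simpa using this
  obtain ⟨q, hq, hq1⟩ := ENNReal.lt_iff_exists_nnreal_btwn.1 hr
  have hq1' : q < 1 := by exact_mod_cast hq1
  have hev := (spectrum.pow_nnnorm_pow_one_div_tendsto_nhds_spectralRadius Φ).eventually
    (gt_mem_nhds hq)
  have hle : ∀ᶠ n : ℕ in atTop, ‖Φ ^ n‖ ≤ (q : ℝ) ^ n := by
    filter_upwards [hev, eventually_gt_atTop 0] with n hn hn0
    have hn' : (n : ℝ) ≠ 0 := by positivity
    have h1 := ENNReal.rpow_le_rpow hn.le (by positivity : (0 : ℝ) ≤ n)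
    rw [← ENNReal.rpow_mul, one_div, inv_mul_cancel₀ hn', ENNReal.rpow_one,
      ENNReal.rpow_natCast] at h1
    exact_mod_cast h1
  exact squeeze_zero_norm' hle (tendsto_pow_atTop_nhds_zero_of_lt_one q.2 hq1')

variable {E : Type*} [NormedAddCommGroup E] [NormedSpace ℂ E]

theorem hasDerivAt_exp_ofReal_smul_apply [CompleteSpace E] (A : E →L[ℂ] E) (x : E) (t : ℝ) :
    HasDerivAt (fun s : ℝ => exp ((s : ℂ) • A) x) (A (exp ((t : ℂ) • A) x)) t := by
  have h1 := (hasDerivAt_exp_smul_const' A (t : ℂ)).scomp t Complex.ofRealCLM.hasDerivAt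
  have h2 := ((ContinuousLinearMap.apply ℂ E x).restrictScalars ℝ).hasFDerivAt.comp_hasDerivAt t h1
  simpa [Function.comp_def] using h2

/-- Solutions of a linear differential equation are given by the operator exponential. -/
theorem eq_exp_of_hasDerivWithinAt [CompleteSpace E] (A : E →L[ℂ] E) {x : ℝ → E}
    (hx : ∀ t : ℝ, 0 ≤ t → HasDerivWithinAt x (A (x t)) (Set.Ici 0) t) {t : ℝ} (ht : 0 ≤ t) :
    x t = exp ((t : ℂ) • A) (x 0) := by
  refine ODE_solution_unique (v := fun _ => A) (K := ‖A‖₊) (a := 0) (b := t) (f := x)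
    (g := fun s => exp ((s : ℂ) • A) (x 0)) (fun _ => A.lipschitz) ?_ ?_ ?_ ?_ ?_ ⟨ht, le_rfl⟩
  · exact fun s hs => (hx s hs.1).continuousWithinAt.mono fun u hu => hu.1
  · exact fun s hs => (hx s hs.1).mono (Set.Ici_subset_Ici.2 hs.1)
  · exact fun s _ => (hasDerivAt_exp_ofReal_smul_apply A (x 0) s).continuousAt.continuousWithinAt
  · exact fun s _ => (hasDerivAt_exp_ofReal_smul_apply A (x 0) s).hasDerivWithinAt
  · simp

/-- A linear operator on a finite-dimensional space whose eigenvalues all have negative real part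
generates a semigroup that tends to zero. -/
theorem tendsto_exp_of_eigenvalues [FiniteDimensional ℂ E] [Nontrivial E] (A : E →L[ℂ] E)
    (h : ∀ (z : ℂ) (x : E), x ≠ 0 → A x = z • x → z.re < 0) :
    Tendsto (fun t : ℝ => exp ((t : ℂ) • A)) atTop (𝓝 0) := by
  have : CompleteSpace E := FiniteDimensional.complete ℂ E
  have hspec : ∀ μ ∈ spectrum ℂ (exp A), ‖μ‖ < 1 := by
    intro μ hμ
    have hμ' : Module.End.HasEigenvalue (exp A : E →L[ℂ] E).toLinearMap μ := by
      rw [Module.End.hasEigenvalue_iff_mem_spectrum]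
      rw [spectrum.mem_iff] at hμ ⊢
      refine fun hu => hμ ?_
      rw [Module.End.isUnit_iff] at hu
      refine ContinuousLinearMap.isUnit_iff_bijective.2 ?_
      exact hu
    -- `A` commutes with `exp A` and so preserves this eigenspace; an eigenvector of `A` inside it
    -- is a joint eigenvector, which forces `μ = e ^ z`.
    set V := Module.End.eigenspace (exp A : E →L[ℂ] E).toLinearMap μ with hV
    have hVA : ∀ x ∈ V, A.toLinearMap x ∈ V := by
      intro x hx
      rw [hV, Module.End.mem_eigenspace_iff] at hx ⊢
      have hc : exp A * A = A * exp A := (Commute.refl A).exp_left.eq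
      have := congrArg (fun B : E →L[ℂ] E => B x) hc
      simp only [mul_apply_eq_comp] at this
      simp only [ContinuousLinearMap.coe_coe] at hx ⊢
      rw [this, hx, map_smul]
    have : Nontrivial V := Submodule.nontrivial_iff_ne_bot.2 hμ'
    obtain ⟨z, hz⟩ := Module.End.exists_eigenvalue (A.toLinearMap.restrict hVA)
    obtain ⟨v, hv⟩ := hz.exists_hasEigenvector
    have hv1 : A v = z • (v : E) := congrArg Subtype.val hv.apply_eq_smul
    have hv0 : (v : E) ≠ 0 := fun e => hv.2 (Subtype.ext e)
    have hv2 : exp A (v : E) = μ • (v : E) := (Module.End.mem_eigenspace_iff).1 v.2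
    have hre := h z v hv0 hv1
    have hd : ∀ t : ℝ, HasDerivAt (fun s : ℝ => Complex.exp (s * z) • (v : E))
        (A (Complex.exp (t * z) • (v : E))) t := by
      intro t
      have h1 : HasDerivAt (fun s : ℝ => (s : ℂ) * z) z t := by
        simpa using (Complex.ofRealCLM.hasDerivAt (x := t)).mul_const z
      have h2 := h1.cexp.smul_const (v : E)
      rwa [map_smul, hv1, smul_smul]
    have h5 := eq_exp_of_hasDerivWithinAt A (fun t _ => (hd t).hasDerivWithinAt) zero_le_one
    simp only [Complex.ofReal_one, one_smul, one_mul, Complex.ofReal_zero, zero_mul,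
      Complex.exp_zero, hv2] at h5
    have h6 : μ = Complex.exp z := (smul_left_injective ℂ hv0 h5).symm
    rw [h6, Complex.norm_exp]
    simpa using hre
  have hpow := tendsto_pow_of_spectrum (exp A) hspec
  obtain ⟨C, hC⟩ := (isCompact_Icc (a := (0 : ℝ)) (b := 1)).exists_bound_of_continuousOn
    (f := fun s : ℝ => exp ((s : ℂ) • A)) fun s _ =>
      ((hasDerivAt_exp_smul_const' A (s : ℂ)).continuousAt.comp
        Complex.continuous_ofReal.continuousAt).continuousWithinAt
  have hfl : Tendsto (fun t : ℝ => exp A ^ ⌊t⌋₊) atTop (𝓝 0) := hpow.comp tendsto_nat_floor_atTop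
  refine squeeze_zero_norm' (a := fun t : ℝ => C * ‖exp A ^ ⌊t⌋₊‖) ?_ ?_
  · filter_upwards [eventually_ge_atTop 0] with t ht
    let := NormedAlgebra.restrictScalars ℚ ℂ (E →L[ℂ] E)
    -- The fractional part of the time contributes a factor bounded on `[0, 1]`, the integer part a
    -- power of `exp A`.
    have hsplit : exp ((t : ℂ) • A) = exp (((t - ⌊t⌋₊ : ℝ) : ℂ) • A) * exp A ^ ⌊t⌋₊ := by
      rw [← exp_nsmul, ← exp_add_of_commute]
      · congr 1
        rw [← Nat.cast_smul_eq_nsmul ℂ, ← add_smul]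
        congr 1
        push_cast
        ring
      · exact ((Commute.refl A).smul_right _).smul_left _
    rw [hsplit]
    refine (norm_mul_le _ _).trans (mul_le_mul_of_nonneg_right ?_ (norm_nonneg _))
    have h1 := Nat.floor_le ht
    have h2 := Nat.lt_floor_add_one t
    exact hC _ ⟨by linarith, by linarith⟩
  · simpa using (hfl.norm.const_mul C)

/-- The linear equation `x' = A x` on a finite-dimensional space has global solutions. -/
theorem exists_linear_trajectory [FiniteDimensional ℂ E] (A : E →ₗ[ℂ] E) (x₀ : E) :
    ∃ x : ℝ → E, x 0 = x₀ ∧ ∀ t, HasDerivAt x (A (x t)) t := by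
  have : CompleteSpace E := FiniteDimensional.complete ℂ E
  exact ⟨fun t => exp ((t : ℂ) • LinearMap.toContinuousLinearMap A) x₀, by simp,
    hasDerivAt_exp_ofReal_smul_apply (LinearMap.toContinuousLinearMap A) x₀⟩

/-- If all eigenvalues of `A` have negative real part, then the origin is stable for `x' = A x` and
attracts all solutions. -/
theorem stable_and_attractive_of_eigenvalues [FiniteDimensional ℂ E] [Nontrivial E]
    (A : E →ₗ[ℂ] E) (h : ∀ (z : ℂ) (x : E), x ≠ 0 → A x = z • x → z.re < 0) :
    (∀ U ∈ 𝓝 (0 : E), ∃ V ∈ 𝓝 (0 : E), ∀ x : ℝ → E,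
      (∀ t : ℝ, 0 ≤ t → HasDerivWithinAt x (A (x t)) (Set.Ici 0) t) → x 0 ∈ V →
        ∀ t : ℝ, 0 ≤ t → x t ∈ U) ∧
    ∀ x : ℝ → E, (∀ t : ℝ, 0 ≤ t → HasDerivWithinAt x (A (x t)) (Set.Ici 0) t) →
      Tendsto x atTop (𝓝 0) := by
  have : CompleteSpace E := FiniteDimensional.complete ℂ E
  set B := LinearMap.toContinuousLinearMap A
  have hlim := tendsto_exp_of_eigenvalues B h
  have hcont : Continuous fun t : ℝ => exp ((t : ℂ) • B) :=
    continuous_iff_continuousAt.2 fun s =>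
      (hasDerivAt_exp_smul_const' B (s : ℂ)).continuousAt.comp
        Complex.continuous_ofReal.continuousAt
  constructor
  · obtain ⟨T, hT⟩ := eventually_atTop.1 (hlim.norm.eventually (gt_mem_nhds
      (show ‖(0 : E →L[ℂ] E)‖ < 1 by simp)))
    obtain ⟨C, hC⟩ := (isCompact_Icc (a := (0 : ℝ)) (b := T)).exists_bound_of_continuousOn
      hcont.continuousOn
    have hbound : ∀ t : ℝ, 0 ≤ t → ‖exp ((t : ℂ) • B)‖ ≤ max C 1 := by
      intro t ht
      rcases le_total t T with h | h
      · exact (hC t ⟨ht, h⟩).trans (le_max_left _ _)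
      · exact (hT t h).le.trans (le_max_right _ _)
    have hpos : 0 < max C 1 := lt_max_of_lt_right one_pos
    intro U hU
    obtain ⟨ε, hε, hεU⟩ := Metric.mem_nhds_iff.1 hU
    refine ⟨Metric.ball 0 (ε / max C 1), Metric.ball_mem_nhds _ (by positivity), ?_⟩
    intro x hx h0 t ht
    apply hεU
    rw [mem_ball_zero_iff] at h0 ⊢
    rw [eq_exp_of_hasDerivWithinAt B hx ht]
    calc _ ≤ ‖exp ((t : ℂ) • B)‖ * ‖x 0‖ := ContinuousLinearMap.le_opNorm _ _
      _ ≤ max C 1 * ‖x 0‖ := by gcongr; exact hbound t ht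
      _ < ε := by rwa [lt_div_iff₀' hpos] at h0
  · intro x hx
    have h1 := ((ContinuousLinearMap.apply ℂ E (x 0)).continuous.tendsto 0).comp hlim
    rw [map_zero] at h1
    refine h1.congr' ?_
    filter_upwards [eventually_ge_atTop 0] with t ht
    exact (eq_exp_of_hasDerivWithinAt B hx ht).symm

theorem _root_.HasDerivWithinAt.linearMap_comp [FiniteDimensional ℂ E] {F : Type*}
    [NormedAddCommGroup F] [NormedSpace ℂ F] (τ : E →ₗ[ℂ] F) {x : ℝ → E} {v : E} {s : Set ℝ}
    {t : ℝ} (h : HasDerivWithinAt x v s t) : HasDerivWithinAt (fun r => τ (x r)) (τ v) s t :=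
  ((LinearMap.toContinuousLinearMap τ).restrictScalars ℝ).hasFDerivAt.comp_hasDerivWithinAt t h

end Exponential

/-! ### Detailed balance and the passage to the Heisenberg picture -/

section Algebra

open Matrix

variable {N : ℕ}

/-- The square root of `targetState p`. -/
def sqrtState (p : Fin N → ℝ) : Matrix (Fin N) (Fin N) ℂ :=
  diagonal fun n => (√(p n) : ℂ)

theorem sqrtState_mul_self {p : Fin N → ℝ} (hp : ∀ n, 0 < p n) :
    sqrtState p * sqrtState p = targetState p := by
  simp only [sqrtState, targetState, diagonal_mul_diagonal]
  congr 1
  ext n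
  exact_mod_cast Real.mul_self_sqrt (hp n).le

theorem conjTranspose_sqrtState (p : Fin N → ℝ) : (sqrtState p)ᴴ = sqrtState p := by
  simp only [sqrtState, diagonal_conjTranspose]
  congr 1
  ext n
  simp

theorem isUnit_sqrtState {p : Fin N → ℝ} (hp : ∀ n, 0 < p n) : IsUnit (sqrtState p) := by
  rw [sqrtState, isUnit_diagonal, Pi.isUnit_iff]
  intro n
  have := (Real.sqrt_pos.2 (hp n)).ne'
  simpa using this

/-- Quantum detailed balance for the noise operator. -/
theorem noiseOp_mul_sqrtState (p a : Fin N → ℝ) :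
    noiseOp p a * sqrtState p = sqrtState p * (noiseOp p a)ᴴ := by
  ext m n
  simp only [sqrtState, mul_diagonal, diagonal_mul, conjTranspose_apply, noiseOp, of_apply]
  by_cases hmn : m = n
  · subst hmn
    simp [mul_comm]
  · rw [if_neg hmn, if_neg (Ne.symm hmn)]
    by_cases h : (m : ℕ) + 1 = n ∨ (n : ℕ) + 1 = m
    · rw [if_pos h, if_pos h.symm]
      simp
    · rw [if_neg h, if_neg (fun e => h e.symm)]
      simp

/-- In the sum for `(L†L) m n` only `k = m, n` survive for adjacent indices, and only the middle
index at distance two; beyond that the bands do not meet. -/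
theorem hamUpper_apply_of_lt {p : Fin N → ℝ} (hp : ∀ n, 0 < p n) (a : Fin N → ℝ) {m n : Fin N}
    (h : m < n) :
    hamUpper p a m n = -(Complex.I / 2) *
      (((√(p m) - √(p n)) / (√(p m) + √(p n)) : ℝ) : ℂ) *
        ((noiseOp p a)ᴴ * noiseOp p a) m n := by
  have hlt : (m : ℕ) < n := h
  simp only [hamUpper, of_apply, mul_apply, conjTranspose_apply]
  by_cases h1 : (m : ℕ) + 1 = n
  · have hmn : m ≠ n := h.ne
    rw [if_pos h1, Fintype.sum_eq_add m n hmn]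
    · simp [noiseOp, hmn, hmn.symm, h1]
      ring
    · rintro k ⟨hkm, hkn⟩
      have hkm' : (k : ℕ) ≠ m := fun e => hkm (Fin.ext e)
      have hkn' : (k : ℕ) ≠ n := fun e => hkn (Fin.ext e)
      by_cases h2 : (k : ℕ) + 1 = m ∨ (m : ℕ) + 1 = k
      · have : ¬((k : ℕ) + 1 = n ∨ (n : ℕ) + 1 = k) := by omega
        simp [noiseOp, hkn, this]
      · simp [noiseOp, hkm, h2]
  · rw [if_neg h1]
    by_cases h2 : (m : ℕ) + 2 = n
    · rw [dif_pos h2, Fintype.sum_eq_single (⟨m + 1, by omega⟩ : Fin N)]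
      · have e1 : (⟨m + 1, by omega⟩ : Fin N) ≠ m := fun e => by
          have := congrArg Fin.val e; simp at this
        have e2 : (⟨m + 1, by omega⟩ : Fin N) ≠ n := fun e => by
          have := congrArg Fin.val e; simp at this; omega
        have hs : ((√(p ⟨m + 1, by omega⟩) : ℝ) : ℂ) * (√(p ⟨m + 1, by omega⟩) : ℝ)
            = (p ⟨m + 1, by omega⟩ : ℂ) := by
          exact_mod_cast Real.mul_self_sqrt (hp _).le
        have e3 : (m : ℕ) + 1 + 1 = n := by omega
        simp [noiseOp, e1, e2, e3]
        rw [← hs]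
        ring
      · intro k hk
        have hk' : (k : ℕ) ≠ m + 1 := fun e => hk (Fin.ext e)
        by_cases h3 : k = m ∨ (k : ℕ) + 1 = m ∨ (m : ℕ) + 1 = k
        · have h4 : ¬((k : ℕ) + 1 = n ∨ (n : ℕ) + 1 = k) := by
            rcases h3 with rfl | h3 <;> omega
          have h5 : k ≠ n := by
            rintro rfl
            rcases h3 with rfl | h3 <;> omega
          simp [noiseOp, h4, h5]
        · push Not at h3
          simp [noiseOp, h3]
    · rw [dif_neg h2, Finset.sum_eq_zero, mul_zero]
      intro k _
      by_cases h3 : k = m ∨ (k : ℕ) + 1 = m ∨ (m : ℕ) + 1 = k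
      · have h4 : ¬((k : ℕ) + 1 = n ∨ (n : ℕ) + 1 = k) := by
          rcases h3 with rfl | h3 <;> omega
        have h5 : k ≠ n := by
          rintro rfl
          rcases h3 with rfl | h3 <;> omega
        simp [noiseOp, h4, h5]
      · push Not at h3
        simp [noiseOp, h3]

theorem hamUpper_apply_of_le (p a : Fin N → ℝ) {m n : Fin N} (h : n ≤ m) :
    hamUpper p a m n = 0 := by
  have hle : (n : ℕ) ≤ m := h
  have h1 : ¬(m : ℕ) + 1 = n := by omega
  have h2 : ¬(m : ℕ) + 2 = n := by omega
  simp [hamUpper, h1, h2]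

/-- The off-diagonal part of the Hamiltonian is a Schur multiple of `L†L`. -/
theorem ham_apply {p : Fin N → ℝ} (hp : ∀ n, 0 < p n) (a h : Fin N → ℝ) (m n : Fin N) :
    ham p a h m n = (if m = n then (h m : ℂ) else 0) + -(Complex.I / 2) *
      (((√(p m) - √(p n)) / (√(p m) + √(p n)) : ℝ) : ℂ) *
        ((noiseOp p a)ᴴ * noiseOp p a) m n := by
  simp only [ham, Matrix.add_apply, diagonal_apply, conjTranspose_apply]
  rcases lt_trichotomy m n with hmn | hmn | hmn
  · rw [hamUpper_apply_of_lt hp a hmn, hamUpper_apply_of_le p a hmn.le]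
    simp
  · subst hmn
    simp [hamUpper_apply_of_le p a le_rfl]
  · rw [hamUpper_apply_of_lt hp a hmn, hamUpper_apply_of_le p a hmn.le, add_zero]
    have hH : ((noiseOp p a)ᴴ * noiseOp p a) m n
        = star (((noiseOp p a)ᴴ * noiseOp p a) n m) := by
      rw [← conjTranspose_apply, conjTranspose_mul, conjTranspose_conjTranspose]
    rw [hH]
    have hs : (√(p n) - √(p m)) / (√(p n) + √(p m))
        = -((√(p m) - √(p n)) / (√(p m) + √(p n))) := by
      rw [← neg_div, neg_sub, add_comm]
    rw [hs]
    simp only [star_mul', Complex.star_def, map_neg, map_div₀, Complex.conj_I,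
      Complex.conj_ofReal, Complex.ofReal_neg, map_ofNat]
    ring

/-- The generator of the dynamics in the Heisenberg picture. -/
def heisenberg (H L Y : Matrix (Fin N) (Fin N) ℂ) : Matrix (Fin N) (Fin N) ℂ :=
  Complex.I • (H * Y - Y * H) + Lᴴ * Y * L - (1 / 2 : ℂ) • (Lᴴ * L * Y + Y * (Lᴴ * L))

/-- With `s = √p` and `z = (L†L) m n`, both sides have off-diagonal entry `-s_m s_n z / (s_m +
s_n)`; this is what the coefficients of `H` are made for. On the diagonal, `-i h` must equal `i`
times the new entry, whence the sign change of `h`. -/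
theorem drift_mul_sqrtState {p : Fin N → ℝ} (hp : ∀ n, 0 < p n) (a h : Fin N → ℝ) :
    ((-Complex.I) • ham p a h - (1 / 2 : ℂ) • ((noiseOp p a)ᴴ * noiseOp p a)) * sqrtState p =
      sqrtState p *
        (Complex.I • ham p a (-h) - (1 / 2 : ℂ) • ((noiseOp p a)ᴴ * noiseOp p a)) := by
  ext m n
  simp only [sqrtState, mul_diagonal, diagonal_mul, Matrix.sub_apply, Matrix.smul_apply,
    ham_apply hp, smul_eq_mul]
  generalize ((noiseOp p a)ᴴ * noiseOp p a) m n = z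
  have hm := Real.sqrt_pos.2 (hp m)
  have hn := Real.sqrt_pos.2 (hp n)
  have hne : ((√(p m) : ℝ) : ℂ) + (√(p n) : ℝ) ≠ 0 := by
    exact_mod_cast (add_pos hm hn).ne'
  push_cast
  by_cases hmn : m = n
  · subst hmn
    simp
    ring
  · rw [if_neg hmn, if_neg hmn]
    field_simp
    ring_nf
    simp only [Complex.I_sq]
    ring

theorem generator_sqrtState {p : Fin N → ℝ} (hp : ∀ n, 0 < p n) (a h : Fin N → ℝ)
    (Y : Matrix (Fin N) (Fin N) ℂ) :
    generator (ham p a h) (noiseOp p a) (sqrtState p * Y * sqrtState p) =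
      sqrtState p * heisenberg (ham p a (-h)) (noiseOp p a) Y * sqrtState p := by
  have h1 := drift_mul_sqrtState hp a h
  have h2 := congrArg conjTranspose h1
  have h3 := noiseOp_mul_sqrtState p a
  have h4 := congrArg conjTranspose h3
  have hH := (ham_isHermitian p a h).eq
  have hK := (ham_isHermitian p a (-h)).eq
  simp only [conjTranspose_mul, conjTranspose_sub, conjTranspose_smul, conjTranspose_sqrtState,
    conjTranspose_conjTranspose, hH, hK, Complex.star_def, map_neg, Complex.conj_I, neg_neg,
    map_div₀, map_one, map_ofNat] at h2 h4
  set H := ham p a h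
  set K := ham p a (-h)
  set L := noiseOp p a
  set S := sqrtState p
  have e1 : generator H L (S * Y * S) =
      (((-Complex.I) • H - (1 / 2 : ℂ) • (Lᴴ * L)) * S) * Y * S
        + S * Y * (S * (Complex.I • H - (1 / 2 : ℂ) • (Lᴴ * L))) + (L * S) * Y * (S * Lᴴ) := by
    simp only [generator, sub_mul, mul_sub, smul_mul_assoc, mul_smul_comm, smul_sub, smul_add,
      Matrix.mul_assoc]
    module
  have e2 : L * S * Y * (S * Lᴴ) = S * Lᴴ * Y * (L * S) := by rw [h4]
  rw [e1, h1, h2, e2]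
  simp only [heisenberg, sub_mul, mul_sub, add_mul, mul_add, smul_mul_assoc, mul_smul_comm,
    smul_sub, smul_add, Matrix.mul_assoc]
  module

theorem trace_generator (H L X : Matrix (Fin N) (Fin N) ℂ) : (generator H L X).trace = 0 := by
  simp only [generator, trace_sub, trace_add, trace_smul, trace_mul_comm H X,
    trace_mul_comm (Lᴴ * L) X]
  rw [Matrix.mul_assoc, trace_mul_comm L (X * Lᴴ), Matrix.mul_assoc]
  simp
  ring

theorem generator_targetState {p : Fin N → ℝ} (hp : ∀ n, 0 < p n) (a h : Fin N → ℝ) :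
    generator (ham p a h) (noiseOp p a) (targetState p) = 0 := by
  have := generator_sqrtState hp a h 1
  rw [Matrix.mul_one, sqrtState_mul_self hp] at this
  rw [this]
  have h0 : heisenberg (ham p a (-h)) (noiseOp p a) 1 = 0 := by
    simp only [heisenberg, Matrix.mul_one, Matrix.one_mul, sub_self, smul_zero, zero_add, ← two_smul ℂ,
      smul_smul]
    simp
  rw [h0]
  simp

theorem isStationaryState_targetState {p : Fin N → ℝ} (hp : ∀ n, 0 < p n) (hsum : ∑ n, p n = 1)
    (a h : Fin N → ℝ) :
    IsStationaryState (ham p a h) (noiseOp p a) (targetState p) := by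
  refine ⟨⟨?_, ?_⟩, generator_targetState hp a h⟩
  · refine PosSemidef.diagonal fun n => ?_
    simpa using (hp n).le
  · rw [targetState, trace_diagonal]
    exact_mod_cast hsum

/-! ### Heisenberg eigenvectors that do not decay -/

/-- The carré du champ identity. -/
theorem heisenberg_mul (H L Z Y : Matrix (Fin N) (Fin N) ℂ) :
    heisenberg H L (Z * Y) = heisenberg H L Z * Y + Z * heisenberg H L Y
      + (Lᴴ * Z - Z * Lᴴ) * (Y * L - L * Y) := by
  simp only [heisenberg, sub_mul, mul_sub, add_mul, mul_add, smul_mul_assoc, mul_smul_comm,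
    smul_sub, smul_add, Matrix.mul_assoc]
  module

theorem conjTranspose_heisenberg {H : Matrix (Fin N) (Fin N) ℂ} (hH : H.IsHermitian)
    (L Y : Matrix (Fin N) (Fin N) ℂ) :
    (heisenberg H L Y)ᴴ = heisenberg H L Yᴴ := by
  simp only [heisenberg, conjTranspose_sub, conjTranspose_add, conjTranspose_smul,
    conjTranspose_mul, conjTranspose_conjTranspose, hH.eq, Complex.star_def, Complex.conj_I,
    map_div₀, map_one, map_ofNat, Matrix.mul_assoc, smul_sub, smul_add]
  module

/-- If the full rank state `S * S` is invariant, then an eigenvector of the Heisenberg generator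
that does not decay commutes with the noise operator. -/
theorem commute_of_heisenberg_eigenvector {H L S Y : Matrix (Fin N) (Fin N) ℂ}
    (hH : H.IsHermitian) (hS : S.IsHermitian) (hSu : IsUnit S)
    (hinv : ∀ X, (S * heisenberg H L X * S).trace = 0) {z : ℂ} (hz : 0 ≤ z.re)
    (hY : heisenberg H L Y = z • Y) (hY0 : Y ≠ 0) : z.re = 0 ∧ Y * L = L * Y := by
  have hYs : heisenberg H L Yᴴ = star z • Yᴴ := by
    rw [← conjTranspose_heisenberg hH, hY, conjTranspose_smul]
  -- Invariance makes the sum of `2 Re z · tr((YS)†YS)` and `tr((CS)†CS)` vanish; both are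
  -- nonnegative, so each is zero.
  have key := hinv (Yᴴ * Y)
  set C := Y * L - L * Y with hC
  have hCs : Lᴴ * Yᴴ - Yᴴ * Lᴴ = Cᴴ := by
    simp [hC]
  rw [heisenberg_mul, hYs, hY, hCs] at key
  have e : S * (star z • Yᴴ * Y + Yᴴ * z • Y + Cᴴ * C) * S
      = (star z + z) • ((Y * S)ᴴ * (Y * S)) + (C * S)ᴴ * (C * S) := by
    simp only [conjTranspose_mul, hS.eq, mul_add, add_mul, smul_mul_assoc, mul_smul_comm,
      add_smul, Matrix.mul_assoc]
  rw [e, trace_add, trace_smul] at key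
  have h1 := (posSemidef_conjTranspose_mul_self (Y * S)).trace_nonneg
  have h2 := (posSemidef_conjTranspose_mul_self (C * S)).trace_nonneg
  have h3 : ((Y * S)ᴴ * (Y * S)).trace ≠ 0 := by
    rw [Ne, trace_conjTranspose_mul_self_eq_zero_iff]
    exact fun h0 => hY0 ((hSu.mul_left_eq_zero).1 h0)
  have hzz : star z + z = ((2 * z.re : ℝ) : ℂ) := by
    rw [add_comm]; simpa using Complex.add_conj z
  rw [hzz] at key
  have h4 : (0 : ℂ) ≤ ((2 * z.re : ℝ) : ℂ) * ((Y * S)ᴴ * (Y * S)).trace :=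
    mul_nonneg (by exact_mod_cast (by positivity : (0 : ℝ) ≤ 2 * z.re)) h1
  rw [smul_eq_mul] at key
  obtain ⟨h5, h6⟩ := (add_eq_zero_iff_of_nonneg h4 h2).1 key
  constructor
  · have := (mul_eq_zero.1 h5).resolve_right h3
    have h7 : 2 * z.re = 0 := by exact_mod_cast this
    linarith
  · rw [trace_conjTranspose_mul_self_eq_zero_iff] at h6
    exact sub_eq_zero.1 ((hSu.mul_left_eq_zero).1 h6)

/-- If moreover the commutant of `H` and `L` is trivial, such an eigenvector is scalar. -/
theorem scalar_of_heisenberg_eigenvector [NeZero N] {H L S Y : Matrix (Fin N) (Fin N) ℂ}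
    (hH : H.IsHermitian) (hS : S.IsHermitian) (hSu : IsUnit S)
    (hinv : ∀ X, (S * heisenberg H L X * S).trace = 0)
    (hcomm : ∀ X, X * L = L * X → X * H = H * X → ∃ c : ℂ, X = c • 1) {z : ℂ} (hz : 0 ≤ z.re)
    (hY : heisenberg H L Y = z • Y) : ∃ c : ℂ, Y = c • 1 := by
  by_cases hY0 : Y = 0
  · exact ⟨0, by simp [hY0]⟩
  have hYs : heisenberg H L Yᴴ = star z • Yᴴ := by
    rw [← conjTranspose_heisenberg hH, hY, conjTranspose_smul]
  obtain ⟨hz0, hYL⟩ := commute_of_heisenberg_eigenvector hH hS hSu hinv hz hY hY0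
  obtain ⟨-, hYsL⟩ := commute_of_heisenberg_eigenvector hH hS hSu hinv (by simpa using hz) hYs
    (by simpa using hY0)
  have hYLs : Y * Lᴴ = Lᴴ * Y := by
    have := congrArg conjTranspose hYsL
    simpa using this.symm
  have hcom : Complex.I • (H * Y - Y * H) = z • Y := by
    rw [← hY, heisenberg]
    have e1 : Lᴴ * Y * L = Lᴴ * L * Y := by rw [Matrix.mul_assoc, hYL, Matrix.mul_assoc]
    have e2 : Y * (Lᴴ * L) = Lᴴ * L * Y := by
      rw [← Matrix.mul_assoc, hYLs, e1]
    rw [e1, e2, ← two_smul ℂ, smul_smul]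
    norm_num
  -- Since `Y` commutes with `L` and `L†`, the dissipator vanishes on it and `[H, Y] = μ Y`, with
  -- `μ` real because `Re z = 0`.
  set μ : ℂ := -Complex.I * z with hμ
  have hHY : H * Y = Y * H + μ • Y := by
    have := congrArg (fun X => (-Complex.I) • X) hcom
    simp only [smul_smul, neg_mul, Complex.I_mul_I, neg_neg, one_smul] at this
    rw [sub_eq_iff_eq_add'] at this
    simpa [hμ] using this
  have hμs : star μ = μ := by
    apply Complex.ext <;> simp [hμ, hz0]
  have hYH : Yᴴ * H = H * Yᴴ + μ • Yᴴ := by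
    have := congrArg conjTranspose hHY
    simpa only [conjTranspose_mul, conjTranspose_add, conjTranspose_smul, hH.eq, hμs] using this
  -- As `μ` is real, the shifts from `Y` and `Y†` cancel in `Y†Y`. Being scalar, it makes `Y` a
  -- nonzero multiple of a unitary.
  obtain ⟨c, hc⟩ := hcomm (Yᴴ * Y)
    (by rw [Matrix.mul_assoc, hYL, ← Matrix.mul_assoc, hYsL, Matrix.mul_assoc])
    (by
      have e1 : Yᴴ * (H * Y) = Yᴴ * Y * H + μ • (Yᴴ * Y) := by
        rw [hHY, mul_add, mul_smul_comm, Matrix.mul_assoc]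
      have e2 : Yᴴ * H * Y = H * (Yᴴ * Y) + μ • (Yᴴ * Y) := by
        rw [hYH, add_mul, smul_mul_assoc, Matrix.mul_assoc]
      rw [Matrix.mul_assoc, e1] at e2
      exact add_right_cancel e2)
  have hc0 : c ≠ 0 := by
    rintro rfl
    rw [zero_smul, conjTranspose_mul_self_eq_zero] at hc
    exact hY0 hc
  have hc' : Y * Yᴴ = c • 1 := by
    have : (c⁻¹ • Yᴴ) * Y = 1 := by
      rw [smul_mul_assoc, hc, smul_smul, inv_mul_cancel₀ hc0, one_smul]
    have := mul_eq_one_comm.1 this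
    rw [mul_smul_comm, inv_smul_eq_iff₀ hc0] at this
    exact this
  -- The trace of `Y†HY` is `c tr H` by cyclicity, but `c tr H + μ c N` by the commutation relation.
  have hμ0 : μ = 0 := by
    have e1 : (Yᴴ * (H * Y)).trace = c * H.trace := by
      rw [trace_mul_comm, Matrix.mul_assoc, hc', mul_smul_comm, Matrix.mul_one, trace_smul,
        smul_eq_mul]
    rw [hHY, mul_add, mul_smul_comm, ← Matrix.mul_assoc, hc, smul_mul_assoc, Matrix.one_mul,
      trace_add, trace_smul, trace_smul, trace_smul, trace_one, smul_eq_mul, smul_eq_mul,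
      smul_eq_mul, add_eq_left] at e1
    have hN : ((Fintype.card (Fin N) : ℕ) : ℂ) ≠ 0 := by
      simpa using NeZero.ne N
    exact (mul_eq_zero.1 e1).resolve_right (mul_ne_zero hc0 hN)
  refine hcomm Y hYL ?_
  rw [hHY, hμ0, zero_smul, add_zero]

end Algebra

/-! ### Triviality of the commutant for generic parameters -/

section Commutant

open Matrix

variable {N : ℕ}

/-- Only scalar matrices commute with both `H` and `L`. -/
def TrivialCommutant (H L : Matrix (Fin N) (Fin N) ℂ) : Prop :=
  ∀ X, X * L = L * X → X * H = H * X → ∃ c : ℂ, X = c • 1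

/-- The first basis vector is cyclic for the noise operator. -/
theorem eq_zero_of_commute_noiseOp [NeZero N] {p : Fin N → ℝ} (hp : ∀ n, 0 < p n) (a : Fin N → ℝ)
    {Y : Matrix (Fin N) (Fin N) ℂ} (hY : Y * noiseOp p a = noiseOp p a * Y)
    (h0 : ∀ m, Y m 0 = 0) : Y = 0 := by
  have key : ∀ k : ℕ, ∀ j : Fin N, (j : ℕ) ≤ k → ∀ m, Y m j = 0 := by
    intro k
    induction k with
    | zero =>
      intro j hj m
      have : j = 0 := Fin.ext (by simpa using hj)
      rw [this, h0]
    | succ k ih =>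
      intro j hj m
      rcases Nat.lt_or_ge (j : ℕ) (k + 1) with hlt | hge
      · exact ih j (by omega) m
      have hjk : (j : ℕ) = k + 1 := by omega
      let i : Fin N := ⟨k, by omega⟩
      -- In column `i = k` of `Y L = L Y` the right side vanishes by induction, and on the left only
      -- `Y m j * √(p j)` is left.
      have h1 := congrFun (congrFun hY m) i
      rw [mul_apply, mul_apply, Finset.sum_eq_zero (s := Finset.univ)
        (f := fun l => noiseOp p a m l * Y l i) (fun l _ => by rw [ih i le_rfl l, mul_zero]),
        Fintype.sum_eq_single j] at h1
      · have hji : j ≠ i := fun e => by rw [e] at hjk; simp [i] at hjk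
        have hij : (i : ℕ) + 1 = j := hjk.symm
        have hs := (Real.sqrt_pos.2 (hp j)).ne'
        simpa [noiseOp, hji, hij, hs] using h1
      · intro l hl
        rcases Nat.lt_or_ge k (l : ℕ) with hkl | hkl
        · have hlj : (l : ℕ) ≠ j := fun e => hl (Fin.ext e)
          have h2 : l ≠ i := fun e => by rw [e] at hkl; simp [i] at hkl
          have h3 : ¬((l : ℕ) + 1 = i ∨ (i : ℕ) + 1 = l) := by
            simp only [i]; omega
          simp [noiseOp, h2, h3]
        · rw [ih l hkl m, zero_mul]
  ext m j
  exact key j j le_rfl m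

/-- Subtracting the scalar matrix `X 0 0` normalises the commutant to a homogeneous linear
condition, so that failure is witnessed by a nonzero vector. -/
theorem trivialCommutant_noiseOp_iff [NeZero N] (p a : Fin N → ℝ)
    (H : Matrix (Fin N) (Fin N) ℂ) :
    TrivialCommutant H (noiseOp p a) ↔
      ∀ X, X * noiseOp p a = noiseOp p a * X → X * H = H * X → X 0 0 = 0 → X = 0 := by
  constructor
  · intro h X hL hH h0
    obtain ⟨c, rfl⟩ := h X hL hH
    have : c = 0 := by simpa using h0
    simp [this]
  · intro h X hL hH
    refine ⟨X 0 0, sub_eq_zero.1 (h (X - X 0 0 • 1) ?_ ?_ ?_)⟩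
    · simp [sub_mul, mul_sub, hL]
    · simp [sub_mul, mul_sub, hH]
    · simp

theorem ham_add_smul_single [NeZero N] (p a g : Fin N → ℝ) (M : ℝ) :
    ham p a (g + M • Pi.single 0 1) = ham p a g + (M : ℂ) • single 0 0 1 := by
  have : (diagonal fun n => (((g + M • Pi.single 0 1 : Fin N → ℝ) n : ℝ) : ℂ))
      = diagonal (fun n => (g n : ℂ)) + (M : ℂ) • single (0 : Fin N) (0 : Fin N) (1 : ℂ) := by
    ext i j
    by_cases hij : i = j
    · subst hij
      by_cases hi : i = 0
      · subst hi; simp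
      · simp [hi, Ne.symm hi]
    · have : ¬(0 = i ∧ 0 = j) := fun e => hij (e.1.symm.trans e.2)
      simp [hij, this]
  rw [ham, ham, this]
  abel

/-- Along every line in the direction of the first diagonal entry, the commutant is trivial with
finitely many exceptions. -/
theorem finite_not_trivialCommutant [NeZero N] {p : Fin N → ℝ} (hp : ∀ n, 0 < p n)
    (a g : Fin N → ℝ) :
    {M : ℝ | ¬TrivialCommutant (ham p a (g + M • Pi.single 0 1)) (noiseOp p a)}.Finite := by
  set L := noiseOp p a
  let P : Matrix (Fin N) (Fin N) ℂ := single 0 0 1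
  let ad (H : Matrix (Fin N) (Fin N) ℂ) :
      Matrix (Fin N) (Fin N) ℂ →ₗ[ℂ] Matrix (Fin N) (Fin N) ℂ :=
    LinearMap.mulRight ℂ H - LinearMap.mulLeft ℂ H
  let V : Submodule ℂ (Matrix (Fin N) (Fin N) ℂ) :=
    LinearMap.ker (ad L) ⊓ LinearMap.ker (entryLinearMap ℂ ℂ 0 0)
  have hV : ∀ X, X ∈ V ↔ X * L = L * X ∧ X 0 0 = 0 := fun X => by
    simp [V, ad, sub_eq_zero]
  -- Commuting with `P` kills the first column below its top entry, which is zero on `V`; cyclicity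
  -- does the rest.
  have hinj : LinearMap.ker ((ad P).comp V.subtype) = ⊥ := by
    rw [LinearMap.ker_eq_bot']
    rintro ⟨X, hX⟩ h
    obtain ⟨hXL, hX0⟩ := (hV X).1 hX
    have h1 : X * P - P * X = 0 := h
    refine Subtype.ext (eq_zero_of_commute_noiseOp hp a hXL fun m => ?_)
    by_cases hm : m = 0
    · rw [hm]
      exact hX0
    · have := congrFun (congrFun h1 m) 0
      simpa [P, hm] using this
  obtain ⟨B, hB⟩ := LinearMap.exists_leftInverse_of_injective _ hinj
  -- If `X` in `V` commutes with `ham p a g + M P`, then `ad (ham p a g) X = -M • ad P X`; applying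
  -- the left inverse `B` of `ad P` makes `-M` an eigenvalue of `T`.
  let T : Module.End ℂ V := B ∘ₗ (ad (ham p a g)).comp V.subtype
  refine ((Module.End.finite_hasEigenvalue T).preimage (f := fun M : ℝ => -(M : ℂ))
    (fun x _ y _ h => by simpa using h)).subset ?_
  intro M hM
  rw [Set.mem_ofPred_eq, trivialCommutant_noiseOp_iff] at hM
  push Not at hM
  obtain ⟨X, hXL, hXH, hX0, hX⟩ := hM
  have hXV : X ∈ V := (hV X).2 ⟨hXL, hX0⟩
  refine Module.End.hasEigenvalue_of_hasEigenvector (x := ⟨X, hXV⟩)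
    ⟨Module.End.mem_eigenspace_iff.2 ?_, fun e => hX (congrArg Subtype.val e)⟩
  have h1 : ad (ham p a g) X = -(M : ℂ) • ad P X := by
    rw [ham_add_smul_single, mul_add, add_mul, mul_smul_comm, smul_mul_assoc] at hXH
    simp only [ad, LinearMap.sub_apply, LinearMap.mulRight_apply, LinearMap.mulLeft_apply, P]
    rw [smul_sub, neg_smul, neg_smul, sub_neg_eq_add, sub_eq_iff_eq_add, neg_add_eq_sub,
      sub_add_eq_add_sub, eq_sub_iff_add_eq, hXH, add_comm]
  change B (ad (ham p a g) X) = -(M : ℂ) • _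
  rw [h1, map_smul]
  congr 1
  exact LinearMap.congr_fun hB ⟨X, hXV⟩

theorem continuous_noiseOp (p : Fin N → ℝ) : Continuous (noiseOp p) := by
  refine continuous_matrix fun m n => ?_
  simp only [noiseOp, of_apply]
  split_ifs <;> fun_prop

theorem continuous_hamUpper (p : Fin N → ℝ) : Continuous (hamUpper p) := by
  refine continuous_matrix fun m n => ?_
  simp only [hamUpper, of_apply]
  split_ifs <;> fun_prop

theorem continuous_ham (p : Fin N → ℝ) :
    Continuous fun q : (Fin N → ℝ) × (Fin N → ℝ) => ham p q.1 q.2 := by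
  have h1 := (continuous_hamUpper p).comp (continuous_fst (X := Fin N → ℝ) (Y := Fin N → ℝ))
  refine (Continuous.add ?_ h1).add h1.matrix_conjTranspose
  exact Continuous.matrix_diagonal (by fun_prop)

-- Witnesses can be normalised to the compact unit sphere, and projecting a closed set along a
-- compact factor is a closed map.
open scoped Matrix.Norms.Elementwise in
theorem isClosed_not_trivialCommutant [NeZero N] (p : Fin N → ℝ) :
    IsClosed {q : (Fin N → ℝ) × (Fin N → ℝ) |
      ¬TrivialCommutant (ham p q.1 q.2) (noiseOp p q.1)} := by
  let Sph := Metric.sphere (0 : Matrix (Fin N) (Fin N) ℂ) 1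
  have : ProperSpace (Matrix (Fin N) (Fin N) ℂ) := FiniteDimensional.proper ℂ _
  have : CompactSpace Sph := isCompact_iff_compactSpace.1 (isCompact_sphere _ _)
  let C : Set (((Fin N → ℝ) × (Fin N → ℝ)) × Sph) :=
    {x | (x.2 : Matrix (Fin N) (Fin N) ℂ) * noiseOp p x.1.1 = noiseOp p x.1.1 * x.2} ∩
    {x | (x.2 : Matrix (Fin N) (Fin N) ℂ) * ham p x.1.1 x.1.2 = ham p x.1.1 x.1.2 * x.2} ∩
    {x | (x.2 : Matrix (Fin N) (Fin N) ℂ) 0 0 = 0}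
  have hX : Continuous fun x : ((Fin N → ℝ) × (Fin N → ℝ)) × Sph =>
    (x.2 : Matrix (Fin N) (Fin N) ℂ) := continuous_subtype_val.comp continuous_snd
  have hL : Continuous fun x : ((Fin N → ℝ) × (Fin N → ℝ)) × Sph => noiseOp p x.1.1 :=
    (continuous_noiseOp p).comp (continuous_fst.comp continuous_fst)
  have hH : Continuous fun x : ((Fin N → ℝ) × (Fin N → ℝ)) × Sph => ham p x.1.1 x.1.2 :=
    (continuous_ham p).comp continuous_fst
  have hC : IsClosed C :=
    ((isClosed_eq (hX.matrix_mul hL) (hL.matrix_mul hX)).inter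
      (isClosed_eq (hX.matrix_mul hH) (hH.matrix_mul hX))).inter
      (isClosed_eq (hX.matrix_elem 0 0) continuous_const)
  convert isClosedMap_fst_of_compactSpace C hC using 1
  ext q
  rw [Set.mem_ofPred_eq, trivialCommutant_noiseOp_iff]
  push Not
  constructor
  · rintro ⟨X, h1, h2, h3, h4⟩
    have hn : ‖X‖ ≠ 0 := norm_ne_zero_iff.2 h4
    refine ⟨(q, ⟨((‖X‖⁻¹ : ℝ) : ℂ) • X, ?_⟩), ⟨⟨?_, ?_⟩, ?_⟩, rfl⟩
    · rw [mem_sphere_zero_iff_norm, norm_smul, Complex.norm_real, norm_inv, norm_norm,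
        inv_mul_cancel₀ hn]
    · simp [h1]
    · simp [h2]
    · simp [h3]
  · rintro ⟨⟨q, X, hX⟩, ⟨⟨h1, h2⟩, h3⟩, rfl⟩
    exact ⟨X, h1, h2, h3, ne_zero_of_mem_unit_sphere ⟨X, hX⟩⟩

/-- Every line in the direction of the first entry of `h` meets this closed set in a finite, hence
null, set. -/
theorem volume_not_trivialCommutant [NeZero N] {p : Fin N → ℝ} (hp : ∀ n, 0 < p n) :
    MeasureTheory.volume {q : (Fin N → ℝ) × (Fin N → ℝ) |
      ¬TrivialCommutant (ham p q.1 q.2) (noiseOp p q.1)} = 0 := by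
  have hcl := (isClosed_not_trivialCommutant p).measurableSet.compl
  have hHaar : (MeasureTheory.volume :
      MeasureTheory.Measure ((Fin N → ℝ) × (Fin N → ℝ))).IsAddHaarMeasure :=
    MeasureTheory.Measure.prod.instIsAddHaarMeasure _ _
  let l : ℝ →ₗ[ℝ] (Fin N → ℝ) × (Fin N → ℝ) := LinearMap.toSpanSingleton ℝ _ (0, Pi.single 0 1)
  have := MeasureTheory.ae_mem_of_ae_add_linearMap_mem l MeasureTheory.volume
    MeasureTheory.volume hcl fun y => by
      have hfin := (finite_not_trivialCommutant hp y.1 y.2).measure_zero MeasureTheory.volume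
      filter_upwards [MeasureTheory.measure_eq_zero_iff_ae_notMem.1 hfin] with M hM
      simpa [l] using hM
  exact MeasureTheory.measure_eq_zero_iff_ae_notMem.2 this

end Commutant

/-! ### From trivial commutant to global asymptotic stability -/

section Stability

open Matrix Filter

variable {N : ℕ}

/-- The generator as a linear map. -/
def generatorLinear (H L : Matrix (Fin N) (Fin N) ℂ) :
    Matrix (Fin N) (Fin N) ℂ →ₗ[ℂ] Matrix (Fin N) (Fin N) ℂ where
  toFun := generator H L
  map_add' X Y := by
    simp only [generator, mul_add, add_mul]
    module
  map_smul' c X := by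
    simp only [generator, mul_smul_comm, smul_mul_assoc, RingHom.id_apply]
    module

/-- The generator corrected by a rank one term, so that it no longer vanishes at `ρ`. -/
def shiftedGenerator (H L ρ : Matrix (Fin N) (Fin N) ℂ) :
    Matrix (Fin N) (Fin N) ℂ →ₗ[ℂ] Matrix (Fin N) (Fin N) ℂ :=
  generatorLinear H L - (traceLinearMap (Fin N) ℂ ℂ).smulRight ρ

theorem shiftedGenerator_apply (H L ρ X : Matrix (Fin N) (Fin N) ℂ) :
    shiftedGenerator H L ρ X = generator H L X - X.trace • ρ := rfl

theorem re_neg_of_shiftedGenerator_eigenvector [NeZero N] {p : Fin N → ℝ} (hp : ∀ n, 0 < p n)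
    (hsum : ∑ n, p n = 1) (a h : Fin N → ℝ)
    (hc : TrivialCommutant (ham p a (-h)) (noiseOp p a)) {z : ℂ} {X : Matrix (Fin N) (Fin N) ℂ}
    (hX0 : X ≠ 0) (hX : shiftedGenerator (ham p a h) (noiseOp p a) (targetState p) X = z • X) :
    z.re < 0 := by
  by_contra hz
  push Not at hz
  rw [shiftedGenerator_apply] at hX
  have htr : (targetState p).trace = 1 := (isStationaryState_targetState hp hsum a h).1.2
  -- Taking traces gives `-tr X = z tr X`, and `z = -1` is excluded by `Re z ≥ 0`.
  have hXtr : X.trace = 0 := by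
    have h1 := congrArg trace hX
    rw [trace_sub, trace_smul, trace_smul, trace_generator, htr, smul_eq_mul, smul_eq_mul,
      mul_one, zero_sub, neg_eq_iff_add_eq_zero, ← one_add_mul] at h1
    refine (mul_eq_zero.1 h1).resolve_left fun h2 => ?_
    have := congrArg Complex.re h2
    simp at this
    linarith
  rw [hXtr, zero_smul, sub_zero] at hX
  have hSu := isUnit_sqrtState hp
  have hSH : (sqrtState p).IsHermitian := conjTranspose_sqrtState p
  obtain ⟨R, hR⟩ := hSu.exists_right_inv
  have hR' : R * sqrtState p = 1 := mul_eq_one_comm.1 hR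
  set S := sqrtState p
  have hXY : X = S * (R * X * R) * S := by
    rw [← Matrix.mul_assoc, ← Matrix.mul_assoc, hR, Matrix.one_mul, Matrix.mul_assoc, hR',
      Matrix.mul_one]
  have hY : heisenberg (ham p a (-h)) (noiseOp p a) (R * X * R) = z • (R * X * R) := by
    have h1 := generator_sqrtState hp a h (R * X * R)
    rw [← hXY, hX] at h1
    have h2 := congrArg (fun W => R * W * R) h1
    simp only [mul_smul_comm, smul_mul_assoc] at h2
    generalize heisenberg (ham p a (-h)) (noiseOp p a) (R * X * R) = W at h2 ⊢
    rw [h2, ← Matrix.mul_assoc, ← Matrix.mul_assoc, hR', Matrix.one_mul, Matrix.mul_assoc, hR,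
      Matrix.mul_one]
  obtain ⟨c, hcY⟩ := scalar_of_heisenberg_eigenvector (ham_isHermitian p a (-h)) hSH hSu
    (fun W => by rw [← generator_sqrtState hp a h W, trace_generator]) hc hz hY
  rw [hcY, mul_smul_comm, smul_mul_assoc, Matrix.mul_one, sqrtState_mul_self hp] at hXY
  rw [hXY, trace_smul, htr, smul_eq_mul, mul_one] at hXtr
  exact hX0 (by rw [hXY, hXtr, zero_smul])

open scoped Matrix.Norms.Elementwise in
theorem IsTrajectory.trace_eq_one {H L : Matrix (Fin N) (Fin N) ℂ}
    {σ : ℝ → Matrix (Fin N) (Fin N) ℂ} (hσ : IsTrajectory H L σ) {t : ℝ} (ht : 0 ≤ t) :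
    (σ t).trace = 1 := by
  have hd : ∀ s : ℝ, 0 ≤ s → HasDerivWithinAt (fun r => (σ r).trace) 0 (Set.Ici 0) s :=
    fun s hs => ((hσ.2 s hs).linearMap_comp (traceLinearMap (Fin N) ℂ ℂ)).congr_deriv
      (trace_generator H L (σ s))
  have := constant_of_has_deriv_right_zero (a := 0) (b := t)
    (fun s hs => (hd s hs.1).continuousWithinAt.mono fun u hu => hu.1)
    (fun s hs => (hd s hs.1).mono (Set.Ici_subset_Ici.2 hs.1)) t ⟨ht, le_rfl⟩
  exact this.trans hσ.1.2

-- Trajectories keep trace one, so the difference is traceless and the rank one correction does not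
-- act on it.
open scoped Matrix.Norms.Elementwise in
theorem IsTrajectory.sub_stationary {H L ρ : Matrix (Fin N) (Fin N) ℂ}
    (hρ : IsStationaryState H L ρ) {σ : ℝ → Matrix (Fin N) (Fin N) ℂ} (hσ : IsTrajectory H L σ)
    {t : ℝ} (ht : 0 ≤ t) :
    HasDerivWithinAt (fun s => σ s - ρ) (shiftedGenerator H L ρ (σ t - ρ)) (Set.Ici 0) t := by
  have h1 : shiftedGenerator H L ρ (σ t - ρ) = generator H L (σ t) := by
    rw [map_sub, shiftedGenerator_apply, shiftedGenerator_apply, hσ.trace_eq_one ht, hρ.1.2, hρ.2]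
    abel
  rw [h1]
  exact (hσ.2 t ht).sub_const ρ

open scoped Matrix.Norms.Elementwise in
theorem exists_isTrajectory (H L ρ₀ : Matrix (Fin N) (Fin N) ℂ) (h : IsDensity ρ₀) :
    ∃ σ, IsTrajectory H L σ ∧ σ 0 = ρ₀ := by
  obtain ⟨σ, h0, hσ⟩ := exists_linear_trajectory (generatorLinear H L) ρ₀
  exact ⟨σ, ⟨by rwa [h0], fun t _ => (hσ t).hasDerivWithinAt⟩, h0⟩

open scoped Matrix.Norms.Elementwise in
/-- A stationary state is globally asymptotically stable as soon as the shifted generator has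
only decaying eigenvectors. -/
theorem isGAS_of_eigenvalues [NeZero N] {H L ρ : Matrix (Fin N) (Fin N) ℂ}
    (hρ : IsStationaryState H L ρ)
    (hA : ∀ (z : ℂ) (X : Matrix (Fin N) (Fin N) ℂ), X ≠ 0 →
      shiftedGenerator H L ρ X = z • X → z.re < 0) : IsGAS H L ρ := by
  obtain ⟨hst, hat⟩ := stable_and_attractive_of_eigenvalues (shiftedGenerator H L ρ) hA
  refine ⟨hρ, exists_isTrajectory H L, fun U hU => ?_, fun σ hσ => ?_⟩
  · have hadd : Tendsto (fun X : Matrix (Fin N) (Fin N) ℂ => X + ρ) (𝓝 0) (𝓝 ρ) := by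
      simpa using (continuous_add_const ρ).tendsto (0 : Matrix (Fin N) (Fin N) ℂ)
    have hsub : Tendsto (fun X : Matrix (Fin N) (Fin N) ℂ => X - ρ) (𝓝 ρ) (𝓝 0) := by
      simpa using (continuous_id.sub continuous_const).tendsto (f := fun X => X - ρ) ρ
    obtain ⟨V, hV, hVU⟩ := hst _ (hadd hU)
    refine ⟨_, hsub hV, fun σ hσ h0 t ht => ?_⟩
    simpa using hVU _ (fun s hs => hσ.sub_stationary hρ hs) h0 t ht
  · have := (hat _ fun s hs => hσ.sub_stationary hρ hs).add_const ρ
    simp only [sub_add_cancel, zero_add] at this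
    exact this

theorem isGAS_of_trivialCommutant [NeZero N] {p : Fin N → ℝ} (hp : ∀ n, 0 < p n)
    (hsum : ∑ n, p n = 1) {a h : Fin N → ℝ}
    (hc : TrivialCommutant (ham p a (-h)) (noiseOp p a)) :
    IsGAS (ham p a h) (noiseOp p a) (targetState p) :=
  isGAS_of_eigenvalues (isStationaryState_targetState hp hsum a h)
    fun _ _ => re_neg_of_shiftedGenerator_eigenvector hp hsum a h hc

end Stability

end LindbladStab

end

/-! ### The main theorem -/

theorem mainTheorem1 {N : ℕ} (p : Fin N → ℝ) (hp : ∀ n, 0 < p n) (hsum : ∑ n, p n = 1) :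
    (∀ a h : Fin N → ℝ,
      LindbladStab.IsStationaryState (LindbladStab.ham p a h) (LindbladStab.noiseOp p a)
        (LindbladStab.targetState p)) ∧
    (∃ Z : Set ((Fin N → ℝ) × (Fin N → ℝ)), IsClosed Z ∧ MeasureTheory.volume Z = 0 ∧
      ∀ a h : Fin N → ℝ, (a, h) ∉ Z →
        LindbladStab.IsGAS (LindbladStab.ham p a h) (LindbladStab.noiseOp p a)
          (LindbladStab.targetState p)) ∧
    (∀ a : Fin N → ℝ, ∃ M₀ : ℝ, 0 ≤ M₀ ∧ ∀ M : ℝ, M₀ < M →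
      LindbladStab.IsGAS
        (LindbladStab.ham p a (fun n => if (n : ℕ) = 0 then M else 0))
        (LindbladStab.noiseOp p a) (LindbladStab.targetState p)) := by
  have hN : N ≠ 0 := by
    rintro rfl
    simp at hsum
  have : NeZero N := ⟨hN⟩
  refine ⟨LindbladStab.isStationaryState_targetState hp hsum, ?_, ?_⟩
  · refine ⟨(fun q => (q.1, -q.2)) ⁻¹' {q | ¬LindbladStab.TrivialCommutant
      (LindbladStab.ham p q.1 q.2) (LindbladStab.noiseOp p q.1)},
      (LindbladStab.isClosed_not_trivialCommutant p).preimage (by fun_prop), ?_, ?_⟩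
    · have hmp : MeasureTheory.MeasurePreserving
          (fun q : (Fin N → ℝ) × (Fin N → ℝ) => (q.1, -q.2)) :=
        (MeasureTheory.MeasurePreserving.id _).prod
          (MeasureTheory.Measure.measurePreserving_neg _)
      rw [hmp.measure_preimage
        (LindbladStab.isClosed_not_trivialCommutant p).measurableSet.nullMeasurableSet]
      exact LindbladStab.volume_not_trivialCommutant hp
    · intro a h hah
      exact LindbladStab.isGAS_of_trivialCommutant hp hsum (not_not.1 hah)
  · intro a
    -- By the same reflection the relevant parameter is `-M`, so a lower bound `b` of the
    -- exceptional set is needed: `M > -b` avoids it.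
    obtain ⟨b, hb⟩ := (LindbladStab.finite_not_trivialCommutant hp a 0).bddBelow
    refine ⟨max 0 (-b), le_max_left _ _, fun M hM => ?_⟩
    refine LindbladStab.isGAS_of_trivialCommutant hp hsum ?_
    have e : -(fun n : Fin N => if (n : ℕ) = 0 then M else 0) = 0 + (-M) • Pi.single 0 1 := by
      ext n
      by_cases hn : n = 0
      · simp [hn]
      · simp [hn]
    rw [e]
    by_contra hbad
    have h1 := hb hbad
    have h2 := (le_max_right 0 (-b)).trans_lt hM
    linarith
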